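/- Let $n\ge 0$ be an integer, let $\theta_1,\dots,\theta_n\in\mathbb R$ and $z_j=e^{-i\theta_j}$. Let $T$ be the translation on $L^2(\mathbb R)^n$ given by $T(\varphi_1,\dots,\varphi_n)=(z_1\varphi_1(\cdot-1),\dots,z_n\varphi_n(\cdot-1))$. With $\hat f(\xi)=\int_{\mathbb R}f(x)e^{-i\xi x}\,dx$ (extended to $L^2(\mathbb R)$ by Plancherel's theorem), the fiber of $\varphi=(\varphi_1,\dots,\varphi_n)\in L^2(\mathbb R)^n$ at $\xi$ is $$\mathcal T_{per}\varphi(\xi)=\Big(\big(\hat\varphi_j(\xi-\theta_j+2k\pi)\big)_{k\in\mathbb Z}\Big)_{j=1}^n\in \ell^2(\mathbb Z)^n\qquad(\text{a.e. }\xi\in\mathbb R).$$ Inner products are linear in the first variable. Let $V$ be a shift-invariant subspace of $L^2(\mathbb R)^n$, that is, a closed subspace with $T^kV\subseteq V$ for all $k\in\mathbb Z$. Let $J_{per}$ be its periodic range function: a map from $\mathbb R$ to the closed subspaces of $\ell^2(\mathbb Z)^n$ such that $\xi\mapsto\langle J_{per}(\xi)a,b\rangle$ is measurable for all $a,b\in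 \ell^2(\mathbb Z)^n$ (where $J_{per}(\xi)$ also denotes the orthogonal projection onto the subspace $J_{per}(\xi)$), $J_{per}(\xi+2k\pi)=\lambda(k)^*(J_{per}(\xi))$ for all $k\in\mathbb Z$, $\xi\in\mathbb R$, with $(\lambda(k)\alpha)(l,j)=\alpha(l-k,j)$, and $$V=\{f\in L^2(\mathbb R)^n : \mathcal T_{per}f(\xi)\in J_{per}(\xi)\text{ for a.e. }\xi\in\mathbb R\}.$$ Let $\Phi\subseteq V$ be a normalized tight frame (NTF) generator for $V$, that is, $\sum_{k\in\mathbb Z,\ \varphi\in\Phi}|\langle f,T^k\varphi\rangle|^2=\|f\|^2$ for all $f\in V$ (the family is indexed by $\mathbb Z\times\Phi$). For a bounded operator $S$ on $\ell^2(\mathbb Z)^n$ that is positive or of trace class (i.e. $\operatorname{Trace}|S|<\infty$), let $\tau_{V,S}(\xi)=\operatorname{Trace}(S\,J_{per}(\xi))$ be the local trace; it lies in $[0,\infty]$ for positive $S$, where it is understood as $\operatorname{Trace}(J_{per}(\xi)\,S\,J_{per}(\xi))$, and in $\mathbb C$ for trace-class $S$. For $f\in \ell^2(\mathbb Z)^n$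 let $\tau_{V,f}=\tau_{V,P_f}$, where $P_fv=\langle v,f\rangle f$. Then: 1. For every positive operator $S$ on $\ell^2(\mathbb Z)^n$, $$\tau_{V,S}(\xi)=\sum_{\varphi\in\Phi}\langle S\,\mathcal T_{per}\varphi(\xi),\mathcal T_{per}\varphi(\xi)\rangle\quad\text{for a.e. }\xi\in\mathbb R,$$ as an equality in $[0,\infty]$. 2. For every trace-class operator $S$ on $\ell^2(\mathbb Z)^n$ and a.e. $\xi\in\mathbb R$, the operator $S\,J_{per}(\xi)$ is of trace class, and the same formula holds, with an absolutely convergent sum in $\mathbb C$. 3. For every $f\in \ell^2(\mathbb Z)^n$, $$\tau_{V,f}(\xi)=\sum_{\varphi\in\Phi}|\langle f,\mathcal T_{per}\varphi(\xi)\rangle|^2\quad\text{for a.e. }\xi\in\mathbb R,$$ whether $P_f$ is regarded as a positive or as a trace-class operator. 4. Consequently the sums in 1, 2 and 3 do not depend on the choice of the generator: for any other NTF generator $\Psi$ of $V$, replacing $\Phi$ by $\Psi$ changes each of them only on a set of $\xi$ of measure zero. -/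

import Mathlib

open MeasureTheory Filter
open scoped ENNReal FourierTransform

noncomputable section

namespace LocalTrace

/-- The Hilbert space `L²(ℝ)ⁿ`. -/
abbrev L2n (n : ℕ) : Type := PiLp 2 (fun _ : Fin n => Lp ℂ 2 (volume : Measure ℝ))

/-- The Hilbert space `ℓ²(ℤ)`. -/
abbrev L2Z : Type := lp (fun _ : ℤ => ℂ) 2

/-- The Hilbert space `ℓ²(ℤ)ⁿ`. -/
abbrev L2Zn (n : ℕ) : Type := PiLp 2 (fun _ : Fin n => L2Z)

/-! ### Translations, fibers -/

/-- The power `T ^ k` of the translation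
`T (φ₁, …, φₙ) = (z₁ φ₁(· - 1), …, zₙ φₙ(· - 1))`, where `z_j = exp (-i θ_j)`; that is, the `j`-th
component of `T ^ k φ` is `x ↦ exp (-i k θ_j) φ_j (x - k)`. -/
def shift {n : ℕ} (θ : Fin n → ℝ) (k : ℤ) (φ : L2n n) : L2n n :=
  WithLp.toLp 2 fun j =>
    Complex.exp (-(Complex.I * (k : ℂ) * (θ j : ℂ))) •
      Lp.compMeasurePreserving (fun x : ℝ => x - (k : ℝ))
        (measurePreserving_sub_right volume (k : ℝ)) (φ j)

/-- (A representative of) the Fourier transform `f̂(ξ) = ∫ f(x) e^{-i ξ x} dx` of `f ∈ L²(ℝ)`,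
expressed through the Plancherel transform `𝓕 f (w) = ∫ f(x) e^{-2 π i w x} dx`. -/
def hat (f : Lp ℂ 2 (volume : Measure ℝ)) (ξ : ℝ) : ℂ :=
  (𝓕 f : Lp ℂ 2 (volume : Measure ℝ)) (ξ / (2 * Real.pi))

open Classical in
/-- The sequence `(f̂(ξ + 2 k π))_{k ∈ ℤ}` as an element of `ℓ²(ℤ)`. It is square summable for
almost every `ξ`; on the exceptional null set the value is `0`. -/
def fiber₁ (f : Lp ℂ 2 (volume : Measure ℝ)) (ξ : ℝ) : L2Z :=
  if h : Memℓp (fun k : ℤ => hat f (ξ + 2 * (k : ℝ) * Real.pi)) 2 then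
    ⟨fun k : ℤ => hat f (ξ + 2 * (k : ℝ) * Real.pi), h⟩
  else 0

/-- The fiber `𝒯_per φ (ξ)`, with components `(φ̂_j(ξ - θ_j + 2 k π))_{k ∈ ℤ}`, `1 ≤ j ≤ n`. -/
def fiber {n : ℕ} (θ : Fin n → ℝ) (φ : L2n n) (ξ : ℝ) : L2Zn n :=
  WithLp.toLp 2 fun j => fiber₁ (φ j) (ξ - θ j)

/-! ### Shift invariant subspaces and normalized tight frame generators -/

/-- A closed subspace `V` of `L²(ℝ)ⁿ` is shift invariant if `T ^ k V ⊆ V` for all `k ∈ ℤ`. -/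
def IsShiftInvariant {n : ℕ} (θ : Fin n → ℝ) (V : ClosedSubmodule ℂ (L2n n)) : Prop :=
  ∀ k : ℤ, ∀ φ ∈ V, shift θ k φ ∈ V

/-- The family `e` is a normalized tight frame for the closed subspace `V`. -/
def IsNTF {H ι : Type*} [NormedAddCommGroup H] [InnerProductSpace ℂ H]
    (V : ClosedSubmodule ℂ H) (e : ι → H) : Prop :=
  (∀ i, e i ∈ V) ∧ ∀ f ∈ V, HasSum (fun i => ‖inner ℂ f (e i)‖ ^ 2) (‖f‖ ^ 2)

/-- `Φ` is a normalized tight frame generator for `V`: `Φ ⊆ V` and the family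
`(T ^ k φ)`, indexed by `(k, φ) ∈ ℤ × Φ`, is a normalized tight frame for `V`. -/
def IsNTFGenerator {n : ℕ} (θ : Fin n → ℝ) (V : ClosedSubmodule ℂ (L2n n))
    (Φ : Set (L2n n)) : Prop :=
  (∀ φ ∈ Φ, φ ∈ V) ∧ IsNTF V (fun p : ℤ × Φ => shift θ p.1 (p.2 : L2n n))

/-! ### Range functions -/

theorem memℓp_shift (s : ℤ) (v : L2Z) : Memℓp (fun k : ℤ => v (k - s)) 2 := by
  have h := (memℓp_gen_iff (by norm_num : 0 < (2 : ℝ≥0∞).toReal)).1 (lp.memℓp v)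
  exact memℓp_gen (((Equiv.subRight s).summable_iff).2 h)

/-- The bilateral shift `(k ↦ v k) ↦ (k ↦ v (k - s))` on `ℓ²(ℤ)`. -/
def lam₁ (s : ℤ) : L2Z ≃ₗᵢ[ℂ] L2Z where
  toFun v := ⟨fun k => v (k - s), memℓp_shift s v⟩
  invFun v := ⟨fun k => v (k - (-s)), memℓp_shift (-s) v⟩
  map_add' v w := by ext k; rfl
  map_smul' c v := by ext k; rfl
  left_inv v := by
    ext k
    change (v : ℤ → ℂ) (k - (-s) - s) = (v : ℤ → ℂ) k
    exact congrArg (v : ℤ → ℂ) (by omega)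
  right_inv v := by
    ext k
    change (v : ℤ → ℂ) (k - s - (-s)) = (v : ℤ → ℂ) k
    exact congrArg (v : ℤ → ℂ) (by omega)
  norm_map' v := by
    have h2 : 0 < (2 : ℝ≥0∞).toReal := by norm_num
    rw [lp.norm_eq_tsum_rpow h2, lp.norm_eq_tsum_rpow h2]
    congr 1
    exact (Equiv.subRight s).tsum_eq (fun k => ‖v k‖ ^ (2 : ℝ≥0∞).toReal)

/-- The unitary shift `(λ(s) α)(k, j) = α(k - s, j)` on `ℓ²(ℤ)ⁿ`. -/
def lam {n : ℕ} (s : ℤ) : L2Zn n ≃ₗᵢ[ℂ] L2Zn n :=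
  LinearIsometryEquiv.piLpCongrRight 2 (fun _ : Fin n => lam₁ s)

/-- The orthogonal projection onto a closed subspace of a Hilbert space. -/
def proj {H : Type*} [NormedAddCommGroup H] [InnerProductSpace ℂ H] [CompleteSpace H]
    (K : ClosedSubmodule ℂ H) : H →L[ℂ] H :=
  K.toSubmodule.starProjection

/-- A periodic range function: a (Lebesgue) weakly measurable map `J` from `ℝ` to the closed
subspaces of `ℓ²(ℤ)ⁿ` with `J(ξ + 2 k π) = λ(k)* J(ξ)`. Here `λ(k)* = λ(k)⁻¹`. -/
structure IsPeriodicRangeFunction {n : ℕ} (J : ℝ → ClosedSubmodule ℂ (L2Zn n)) : Prop where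
  measurable : ∀ a b : L2Zn n, AEMeasurable (fun ξ => inner ℂ (proj (J ξ) a) b) volume
  periodic : ∀ (k : ℤ) (ξ : ℝ),
    (J (ξ + 2 * (k : ℝ) * Real.pi) : Set (L2Zn n)) = (lam k).symm '' (J ξ : Set (L2Zn n))

/-- `J` is the periodic range function of `V`:
`V = {f ∈ L²(ℝ)ⁿ | 𝒯_per f (ξ) ∈ J ξ for a.e. ξ}`. -/
structure IsRangeFunctionOf {n : ℕ} (θ : Fin n → ℝ) (V : ClosedSubmodule ℂ (L2n n))
    (J : ℝ → ClosedSubmodule ℂ (L2Zn n)) : Prop extends IsPeriodicRangeFunction J where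
  mem_iff : ∀ f : L2n n, f ∈ V ↔ ∀ᵐ ξ : ℝ, fiber θ f ξ ∈ J ξ

/-! ### Traces -/

section Trace

variable {H : Type*} [NormedAddCommGroup H] [InnerProductSpace ℂ H] [CompleteSpace H]

variable (H) in
/-- A fixed orthonormal basis of the Hilbert space `H`, as a set of vectors. -/
def onb : Set H := (exists_hilbertBasis ℂ H).choose

/-- The trace in `[0, ∞]` of a positive operator. -/
def posTrace (T : H →L[ℂ] H) : ℝ≥0∞ :=
  ∑' e : onb H, ENNReal.ofReal (RCLike.re (inner ℂ (e : H) (T e)))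

/-- `T` is of trace class if its absolute value `|T| = (T* T)^{1/2}` has finite trace. -/
def IsTraceClass (T : H →L[ℂ] H) : Prop := posTrace (CFC.abs T) < ∞

/-- The trace of a trace-class operator. -/
def trace (T : H →L[ℂ] H) : ℂ := ∑' e : onb H, inner ℂ (e : H) (T e)

/-- The rank-one operator `P_f v = ⟨v, f⟩ f` (inner product linear in the first variable; in
Mathlib's convention, `P_f v = inner ℂ f v • f`). -/
def rankOneOp (f : H) : H →L[ℂ] H := InnerProductSpace.rankOne ℂ f f

end Trace

/-- The local trace `Trace (T J(ξ)) ∈ [0, ∞]` for a positive operator `T`; as `T J(ξ)` need not be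
positive, its trace is understood as that of the positive operator `J(ξ) T J(ξ)`. -/
def localTracePos {n : ℕ} (J : ℝ → ClosedSubmodule ℂ (L2Zn n)) (T : L2Zn n →L[ℂ] L2Zn n)
    (ξ : ℝ) : ℝ≥0∞ :=
  posTrace (proj (J ξ) ∘L T ∘L proj (J ξ))

/-- The local trace `Trace (T J(ξ)) ∈ ℂ` for a trace-class operator `T`. -/
def localTrace {n : ℕ} (J : ℝ → ClosedSubmodule ℂ (L2Zn n)) (T : L2Zn n →L[ℂ] L2Zn n)
    (ξ : ℝ) : ℂ :=
  trace (T ∘L proj (J ξ))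

end LocalTrace

end

open LocalTrace

/-! Everything reduces to a fiberwise Parseval identity: for each fixed vector `a` of `ℓ²(ℤ)ⁿ` and
a.e. `ξ`, the sum over `Φ` of `|⟨a, 𝒯_per φ(ξ)⟩|²` equals `‖J(ξ) a‖²` (`IsNTFGenerator.ae_hasSum`).
To obtain it, substitute `ξ = 2πt`. The numbers `⟨f, T^k φ⟩`, `k ∈ ℤ`, are then the Fourier
coefficients on the unit interval of `t ↦ ⟨𝒯_per f, 𝒯_per φ⟩` (`inner_shift`), so Parseval turns the
frame identity for `f` into an identity of integrals over the unit interval. Testing it on those `f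
∈ V` whose fibers are `1_E(t) J(2πt) a`, for all measurable `E`, identifies the integrands a.e.
Periodicity of `J` and of the fibers carries the result to the whole line.

The exceptional null set depends on `a`, but a given operator requires only countably many vectors.
If `S` is positive, the vectors `S^{1/2} e`, with `e` in an orthonormal basis, suffice: the trace of
`P S P` is the squared Hilbert-Schmidt norm of `P S^{1/2}`, and Tonelli interchanges the sums over
the basis and over `Φ`. If `S` is of trace class, write `S = A* B` with Hilbert-Schmidt factors;
polarization at the vectors `A* e` and `B* e`, together with Fubini, gives the formula. Independence
of the generator follows because the local trace involves only `J` and `S`. -/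

namespace LocalTrace

/-! ### Parseval identities, Hilbert-Schmidt factorizations and trace class on an abstract Hilbert
space. -/

section Abstract

open ContinuousLinearMap

theorem tsum_enorm_sq_of_hasSum {ι E : Type*} [NormedAddCommGroup E] {g : ι → E} {c : ℝ}
    (h : HasSum (fun i => ‖g i‖ ^ 2) c) : ∑' i, ‖g i‖ₑ ^ 2 = ENNReal.ofReal c := by
  rw [← h.tsum_eq, ENNReal.ofReal_tsum_of_nonneg (fun _ => by positivity) h.summable]
  simp only [← ofReal_norm, ENNReal.ofReal_pow (norm_nonneg _)]

theorem hasSum_norm_sq_of_tsum_enorm_sq {ι E : Type*} [NormedAddCommGroup E] {g : ι → E} {c : ℝ}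
    (hc : 0 ≤ c) (h : ∑' i, ‖g i‖ₑ ^ 2 = ENNReal.ofReal c) : HasSum (fun i => ‖g i‖ ^ 2) c := by
  have h1 : ∀ i, ‖g i‖ₑ ^ 2 = ENNReal.ofReal (‖g i‖ ^ 2) := fun i => by
    rw [← ofReal_norm, ENNReal.ofReal_pow (norm_nonneg _)]
  simp only [h1] at h
  have h2 := ENNReal.hasSum_toReal (f := fun i => ENNReal.ofReal (‖g i‖ ^ 2))
    (by rw [h]; exact ENNReal.ofReal_ne_top)
  have h3 : ∀ i, (ENNReal.ofReal (‖g i‖ ^ 2)).toReal = ‖g i‖ ^ 2 :=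
    fun i => ENNReal.toReal_ofReal (by positivity)
  rw [← ENNReal.tsum_toReal_eq (fun i => ENNReal.ofReal_ne_top), h, ENNReal.toReal_ofReal hc] at h2
  simpa only [h3] using h2

theorem summable_norm_sq_of_tsum_enorm_sq {ι E : Type*} [NormedAddCommGroup E] {g : ι → E}
    (h : ∑' i, ‖g i‖ₑ ^ 2 ≠ ∞) : Summable (fun i => ‖g i‖ ^ 2) :=
  (hasSum_norm_sq_of_tsum_enorm_sq ENNReal.toReal_nonneg (ENNReal.ofReal_toReal h).symm).summable

theorem summable_mul_of_tsum_enorm_sq {ι : Type*} {f g : ι → ℂ}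
    (hf : ∑' i, ‖f i‖ₑ ^ 2 ≠ ∞) (hg : ∑' i, ‖g i‖ₑ ^ 2 ≠ ∞) : Summable (fun i => f i * g i) := by
  refine Summable.of_norm_bounded ((summable_norm_sq_of_tsum_enorm_sq hf).add
    (summable_norm_sq_of_tsum_enorm_sq hg)) fun i => ?_
  rw [norm_mul]
  nlinarith [sq_nonneg (‖f i‖ - ‖g i‖), sq_nonneg (‖f i‖), sq_nonneg (‖g i‖)]

variable {H : Type*} [NormedAddCommGroup H] [InnerProductSpace ℂ H]

theorem enorm_inner_symm (x y : H) : ‖inner ℂ x y‖ₑ = ‖inner ℂ y x‖ₑ := by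
  rw [← ofReal_norm, ← ofReal_norm, norm_inner_symm]

theorem hilbertBasis_hasSum_sq {κ : Type*} (b : HilbertBasis κ ℂ H) (x : H) :
    HasSum (fun e => ‖inner ℂ (b e) x‖ ^ 2) (‖x‖ ^ 2) := by
  have h := Complex.hasSum_re (b.hasSum_inner_mul_inner x x)
  have h1 : (inner ℂ x x).re = ‖x‖ ^ 2 := inner_self_eq_norm_sq (𝕜 := ℂ) x
  rw [h1] at h
  convert! h using 2 with e
  rw [← inner_conj_symm x (b e), Complex.conj_mul']
  norm_cast

theorem hilbertBasis_tsum_sq {κ : Type*} (b : HilbertBasis κ ℂ H) (x : H) :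
    ∑' e, ‖inner ℂ (b e) x‖ₑ ^ 2 = ‖x‖ₑ ^ 2 := by
  rw [tsum_enorm_sq_of_hasSum (hilbertBasis_hasSum_sq b x), ENNReal.ofReal_pow (norm_nonneg _),
    ofReal_norm]

/-- Polarized form of a Parseval type identity. -/
theorem hasSum_inner_mul_inner_of_sq {ι : Type*} {f : ι → H} {P : H →L[ℂ] H} {u v : H}
    (h : ∀ c ∈ ({1, -1, Complex.I, -Complex.I} : Set ℂ),
      HasSum (fun i => ‖inner ℂ (f i) (u + c • v)‖ ^ 2) (‖P (u + c • v)‖ ^ 2)) :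
    HasSum (fun i => inner ℂ (f i) v * inner ℂ u (f i)) (inner ℂ (P u) (P v)) := by
  have hc : ∀ c ∈ ({1, -1, Complex.I, -Complex.I} : Set ℂ),
      HasSum (fun i => ((‖inner ℂ (f i) u + c * inner ℂ (f i) v‖ : ℂ)) ^ 2)
        ((‖P u + c • P v‖ : ℂ) ^ 2) := fun c hc => by
    have := (Complex.hasSum_ofReal).2 (h c hc)
    simpa [inner_add_right, inner_smul_right] using this
  -- The polarization combination is applied both to the terms and to the limit.
  have key := (((hc 1 (by simp)).sub (hc (-1) (by simp))).add
    (((hc (-Complex.I) (by simp)).sub (hc Complex.I (by simp))).mul_right Complex.I)).div_const 4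
  convert! key using 1
  · ext i
    have := inner_eq_sum_norm_sq_div_four (𝕜 := ℂ) (inner ℂ (f i) u) (inner ℂ (f i) v)
    rw [RCLike.inner_apply, inner_conj_symm] at this
    rw [this]
    simp [sub_eq_add_neg]
  · rw [inner_eq_sum_norm_sq_div_four (𝕜 := ℂ)]
    simp [sub_eq_add_neg]

/-- The diagonal sum `∑ ⟨gᵢ, A* B fᵢ⟩` for Hilbert-Schmidt operators `A` and `B`. -/
theorem hasSum_inner_of_hilbertSchmidt {ι κ : Type*} [CompleteSpace H] (b : HilbertBasis κ ℂ H)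
    {A B S P : H →L[ℂ] H} (hS : ∀ x y, inner ℂ x (S y) = inner ℂ (A x) (B y)) {f g : ι → H}
    (hA : ∑' e, ‖adjoint A (b e)‖ₑ ^ 2 ≠ ∞) (hB : ∑' e, ‖adjoint B (b e)‖ₑ ^ 2 ≠ ∞)
    (hf : ∀ e, ∑' i, ‖inner ℂ (f i) (adjoint B (b e))‖ₑ ^ 2 ≤ ‖adjoint B (b e)‖ₑ ^ 2)
    (hg : ∀ e, ∑' i, ‖inner ℂ (g i) (adjoint A (b e))‖ₑ ^ 2 ≤ ‖adjoint A (b e)‖ₑ ^ 2)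
    (hfg : ∀ e, HasSum (fun i => inner ℂ (g i) (adjoint A (b e)) * inner ℂ (adjoint B (b e)) (f i))
      (inner ℂ (adjoint B (b e)) (P (adjoint A (b e))))) :
    HasSum (fun i => inner ℂ (g i) (S (f i)))
      (∑' e, inner ℂ (adjoint B (b e)) (P (adjoint A (b e)))) := by
  -- The double family is absolutely summable, being a product of two square-summable families.
  -- Below, `h1` sums over `i` first and `h2` over the basis first; Fubini identifies the results.
  have hsum : Summable (fun p : κ × ι =>
      inner ℂ (g p.2) (adjoint A (b p.1)) * inner ℂ (adjoint B (b p.1)) (f p.2)) := by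
    refine summable_mul_of_tsum_enorm_sq ?_ ?_
    · rw [ENNReal.tsum_prod']
      exact ((ENNReal.tsum_le_tsum hg).trans_lt hA.lt_top).ne
    · rw [ENNReal.tsum_prod']
      simp only [fun p q => enorm_inner_symm (adjoint B (b p)) (f q)]
      exact ((ENNReal.tsum_le_tsum hf).trans_lt hB.lt_top).ne
  have h1 := hsum.hasSum.prod_fiberwise hfg
  have h2 := ((Equiv.prodComm ι κ).hasSum_iff.2 hsum.hasSum).prod_fiberwise
    (g := fun i => inner ℂ (g i) (S (f i))) (fun i => by
      rw [hS]
      simpa [adjoint_inner_left, adjoint_inner_right] using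
        b.hasSum_inner_mul_inner (A (g i)) (B (f i)))
  rwa [h1.tsum_eq]

/-- Both sides are the sum of the squared moduli of all matrix entries, by rows or by columns. This
allows contractions and projections to be absorbed on either side of a Hilbert-Schmidt operator. -/
theorem tsum_enorm_sq_adjoint {κ : Type*} [CompleteSpace H] (b : HilbertBasis κ ℂ H)
    (A : H →L[ℂ] H) : ∑' e, ‖adjoint A (b e)‖ₑ ^ 2 = ∑' e, ‖A (b e)‖ₑ ^ 2 := by
  calc ∑' e, ‖adjoint A (b e)‖ₑ ^ 2 = ∑' e, ∑' e', ‖inner ℂ (b e') (adjoint A (b e))‖ₑ ^ 2 := by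
        simp only [hilbertBasis_tsum_sq]
    _ = ∑' e', ∑' e, ‖inner ℂ (b e') (adjoint A (b e))‖ₑ ^ 2 := ENNReal.tsum_comm
    _ = ∑' e', ∑' e, ‖inner ℂ (b e) (A (b e'))‖ₑ ^ 2 := by
        simp only [adjoint_inner_right, fun e e' => enorm_inner_symm (A (b e)) (b e')]
    _ = _ := by simp only [hilbertBasis_tsum_sq]

theorem tsum_enorm_sq_comp_le {κ : Type*} (b : HilbertBasis κ ℂ H)
    (U A : H →L[ℂ] H) (hU : ‖U‖ ≤ 1) :
    ∑' e, ‖U (A (b e))‖ₑ ^ 2 ≤ ∑' e, ‖A (b e)‖ₑ ^ 2 := by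
  refine ENNReal.tsum_le_tsum fun e => ?_
  gcongr
  rw [← ofReal_norm, ← ofReal_norm]
  exact ENNReal.ofReal_le_ofReal ((U.le_opNorm _).trans
    (mul_le_of_le_one_left (norm_nonneg _) hU))

/-- Douglas' factorization lemma. -/
theorem exists_contraction_comp_eq [CompleteSpace H] (A B : H →L[ℂ] H)
    (h : ∀ x, ‖A x‖ ≤ ‖B x‖) : ∃ U : H →L[ℂ] H, ‖U‖ ≤ 1 ∧ ∀ x, U (B x) = A x := by
  -- The assignment `B x ↦ A x` is well defined and contractive on the range of `B`; it extends by
  -- density to the closure `K`, and by zero to the orthogonal complement.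
  set K : Submodule ℂ H := (LinearMap.range (B : H →ₗ[ℂ] H)).topologicalClosure with hK
  have hBK : ∀ x, B x ∈ K := fun x => Submodule.le_topologicalClosure _ ⟨x, rfl⟩
  have : CompleteSpace K :=
    (Submodule.isClosed_topologicalClosure (LinearMap.range (B : H →ₗ[ℂ] H))).completeSpace_coe
  let e : H →ₗ[ℂ] K := (B : H →ₗ[ℂ] H).codRestrict K hBK
  have hd : DenseRange e := by
    intro y
    rw [closure_subtype]
    have : (Subtype.val '' Set.range e : Set H) = LinearMap.range (B : H →ₗ[ℂ] H) := by
      ext z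
      simp [e]
    rw [this]
    exact y.2
  have hn : ∀ x, ‖(A : H →ₗ[ℂ] H) x‖ ≤ 1 * ‖e x‖ := fun x => by
    rw [one_mul]
    exact h x
  refine ⟨(LinearMap.extendOfNorm (A : H →ₗ[ℂ] H) e) ∘L K.orthogonalProjectionOnto, ?_, fun x => ?_⟩
  · refine (opNorm_comp_le _ _).trans ?_
    exact mul_le_one₀ (LinearMap.opNorm_extendOfNorm_le hd zero_le_one hn) (norm_nonneg _)
      (Submodule.orthogonalProjectionOnto_norm_le K)
  · have h1 : K.orthogonalProjectionOnto (B x) = e x :=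
      Submodule.orthogonalProjectionOnto_mem_subspace_eq_self (K := K) ⟨B x, hBK x⟩
    rw [comp_apply, h1]
    exact LinearMap.extendOfNorm_eq hd ⟨1, hn⟩ x

theorem isPositive_rankOneOp (f : H) : (rankOneOp f).IsPositive :=
  InnerProductSpace.isPositive_rankOne_self f

theorem inner_rankOneOp (f x : H) :
    inner ℂ x (rankOneOp f x) = ((‖inner ℂ x f‖ ^ 2 : ℝ) : ℂ) := by
  rw [rankOneOp, InnerProductSpace.rankOne_apply, inner_smul_right, ← inner_conj_symm f x,
    Complex.conj_mul']
  norm_cast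

variable [CompleteSpace H]

variable (H) in
/-- The Hilbert basis underlying `onb H`. -/
noncomputable def onbBasis : HilbertBasis (onb H) ℂ H := (exists_hilbertBasis ℂ H).choose_spec.choose

theorem onbBasis_apply (e : onb H) : onbBasis H e = (e : H) :=
  congrFun (exists_hilbertBasis ℂ H).choose_spec.choose_spec e

theorem isSelfAdjoint_sqrt (T : H →L[ℂ] H) : adjoint (CFC.sqrt T) = CFC.sqrt T :=
  (IsSelfAdjoint.of_nonneg (CFC.sqrt_nonneg T)).adjoint_eq

theorem inner_sqrt {T : H →L[ℂ] H} (hT : 0 ≤ T) (x y : H) :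
    inner ℂ x (T y) = inner ℂ (CFC.sqrt T x) (CFC.sqrt T y) := by
  conv_lhs => rw [← CFC.sqrt_mul_sqrt_self T hT]
  rw [mul_apply_eq_comp, ← adjoint_inner_left, isSelfAdjoint_sqrt]

theorem ofReal_re_inner_self {T : H →L[ℂ] H} (hT : 0 ≤ T) (x : H) :
    ENNReal.ofReal (RCLike.re (inner ℂ x (T x))) = ‖CFC.sqrt T x‖ₑ ^ 2 := by
  rw [inner_sqrt hT, inner_self_eq_norm_sq, ENNReal.ofReal_pow (norm_nonneg _),
    ofReal_norm]

theorem posTrace_eq {T : H →L[ℂ] H} (hT : 0 ≤ T) :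
    posTrace T = ∑' e, ‖CFC.sqrt T (onbBasis H e)‖ₑ ^ 2 := by
  simp only [posTrace, ofReal_re_inner_self hT, onbBasis_apply]

theorem norm_abs_apply (T : H →L[ℂ] H) (x : H) : ‖CFC.abs T x‖ = ‖T x‖ := by
  have h : inner ℂ (CFC.abs T x) (CFC.abs T x) = inner ℂ (T x) (T x) := by
    have h1 : adjoint (CFC.abs T) = CFC.abs T :=
      (IsSelfAdjoint.of_nonneg (CFC.abs_nonneg T)).adjoint_eq
    nth_rw 1 [← h1]
    rw [adjoint_inner_left, ← mul_apply_eq_comp, CFC.abs_mul_abs, mul_apply_eq_comp, star_eq_adjoint,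
      adjoint_inner_right]
  rw [inner_self_eq_norm_sq_to_K, inner_self_eq_norm_sq_to_K] at h
  have h2 : ‖CFC.abs T x‖ ^ 2 = ‖T x‖ ^ 2 := by exact_mod_cast h
  exact (sq_eq_sq₀ (norm_nonneg _) (norm_nonneg _)).1 h2

/-- A trace-class operator is of the form `A* B` with Hilbert-Schmidt operators `A`, `B`. -/
theorem IsTraceClass.exists_factorization {T : H →L[ℂ] H} (hT : IsTraceClass T) :
    ∃ A B : H →L[ℂ] H, (∀ x y, inner ℂ x (T y) = inner ℂ (A x) (B y)) ∧
      ∑' e, ‖adjoint A (onbBasis H e)‖ₑ ^ 2 ≠ ∞ ∧ ∑' e, ‖adjoint B (onbBasis H e)‖ₑ ^ 2 ≠ ∞ := by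
  obtain ⟨U, hU, hUT⟩ := exists_contraction_comp_eq T (CFC.abs T) fun x => (norm_abs_apply T x).ge
  rw [IsTraceClass, posTrace_eq (CFC.abs_nonneg T)] at hT
  -- Since `T = U |T|`, these choices give `A* B = U |T|^{1/2} |T|^{1/2} = T`.
  refine ⟨CFC.sqrt (CFC.abs T) ∘L adjoint U, CFC.sqrt (CFC.abs T), fun x y => ?_, ?_, ?_⟩
  · rw [comp_apply, ← inner_sqrt (CFC.abs_nonneg T), adjoint_inner_left, hUT]
  · rw [adjoint_comp, adjoint_adjoint, isSelfAdjoint_sqrt]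
    exact ((tsum_enorm_sq_comp_le _ _ _ hU).trans_lt hT).ne
  · rw [isSelfAdjoint_sqrt]
    exact hT.ne

/-- Writing `|T| = W T` with a contraction `W`, each diagonal entry `⟨|T| e, e⟩` is an inner product
of `A W* e` and `B e`, hence at most `‖A W* e‖² + ‖B e‖²`, which is summable. -/
theorem isTraceClass_of_factorization {A B T : H →L[ℂ] H}
    (h : ∀ x y, inner ℂ x (T y) = inner ℂ (A x) (B y))
    (hA : ∑' e, ‖adjoint A (onbBasis H e)‖ₑ ^ 2 ≠ ∞)
    (hB : ∑' e, ‖adjoint B (onbBasis H e)‖ₑ ^ 2 ≠ ∞) : IsTraceClass T := by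
  obtain ⟨W, hW, hWT⟩ := exists_contraction_comp_eq (CFC.abs T) T fun x => (norm_abs_apply T x).le
  have hA' : ∑' e, ‖(A ∘L adjoint W) (onbBasis H e)‖ₑ ^ 2 ≠ ∞ := by
    rw [← tsum_enorm_sq_adjoint, adjoint_comp, adjoint_adjoint]
    exact ((tsum_enorm_sq_comp_le _ _ _ hW).trans_lt hA.lt_top).ne
  rw [tsum_enorm_sq_adjoint] at hB
  refine lt_of_le_of_lt ?_ (ENNReal.add_lt_top.2 ⟨hA'.lt_top, hB.lt_top⟩)
  rw [posTrace, ← ENNReal.tsum_add]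
  refine ENNReal.tsum_le_tsum fun e => ?_
  rw [onbBasis_apply, ← hWT, ← adjoint_inner_left, h]
  simp only [← ofReal_norm, ← ENNReal.ofReal_pow (norm_nonneg _)]
  rw [← ENNReal.ofReal_add (by positivity) (by positivity)]
  refine ENNReal.ofReal_le_ofReal ((re_inner_le_norm _ _).trans ?_)
  rw [comp_apply]
  nlinarith [sq_nonneg (‖A (adjoint W (e : H))‖ - ‖B (e : H)‖), sq_nonneg ‖A (adjoint W (e : H))‖,
    sq_nonneg ‖B (e : H)‖]

/-! ### Traces of operators cut down by the projection onto a closed subspace. -/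

section Projection

variable (K : ClosedSubmodule ℂ H)

theorem inner_proj_left (x y : H) : inner ℂ (proj K x) y = inner ℂ x (proj K y) :=
  Submodule.inner_starProjection_left_eq_right _ x y

theorem proj_proj (x : H) : proj K (proj K x) = proj K x :=
  Submodule.starProjection_eq_self_iff.2 (Submodule.starProjection_apply_mem _ x)

theorem norm_proj_apply_le (x : H) : ‖proj K x‖ ≤ ‖x‖ :=
  Submodule.norm_starProjection_apply_le _ x

theorem adjoint_proj : adjoint (proj K) = proj K :=
  (eq_adjoint_iff _ _).2 (inner_proj_left K) |>.symm

variable {K}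

/-- Positive operators: the trace of the compression to `K` from a Parseval type identity. -/
theorem tsum_inner_eq_posTrace {ι : Type*} {f : ι → H} {S : H →L[ℂ] H} (hS : S.IsPositive)
    (h : ∀ e, HasSum (fun i => ‖inner ℂ (f i) (CFC.sqrt S (onbBasis H e))‖ ^ 2)
      (‖proj K (CFC.sqrt S (onbBasis H e))‖ ^ 2)) :
    posTrace (proj K ∘L S ∘L proj K) =
      ∑' i, ENNReal.ofReal (RCLike.re (inner ℂ (f i) (S (f i)))) := by
  have hS' : 0 ≤ S := (nonneg_iff_isPositive S).2 hS
  have h' : ∀ e, ∑' i, ‖inner ℂ (f i) (CFC.sqrt S (onbBasis H e))‖ₑ ^ 2 =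
      ‖proj K (CFC.sqrt S (onbBasis H e))‖ₑ ^ 2 := fun e => by
    rw [tsum_enorm_sq_of_hasSum (h e), ENNReal.ofReal_pow (norm_nonneg _), ofReal_norm]
  -- The trace is the squared Hilbert-Schmidt norm of `S^{1/2} P`, equivalently of its adjoint `P
  -- S^{1/2}`. In the latter form the hypothesis applies termwise, and Tonelli does the rest.
  calc posTrace (proj K ∘L S ∘L proj K)
      = ∑' e, ‖(CFC.sqrt S ∘L proj K) (onbBasis H e)‖ₑ ^ 2 := by
        simp only [posTrace, comp_apply, ← inner_proj_left, ofReal_re_inner_self hS',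
          onbBasis_apply]
    _ = ∑' e, ‖proj K (CFC.sqrt S (onbBasis H e))‖ₑ ^ 2 := by
        rw [← tsum_enorm_sq_adjoint, adjoint_comp, isSelfAdjoint_sqrt, adjoint_proj]
        rfl
    _ = ∑' e, ∑' i, ‖inner ℂ (f i) (CFC.sqrt S (onbBasis H e))‖ₑ ^ 2 := by simp only [h']
    _ = ∑' i, ∑' e, ‖inner ℂ (f i) (CFC.sqrt S (onbBasis H e))‖ₑ ^ 2 := ENNReal.tsum_comm
    _ = ∑' i, ‖CFC.sqrt S (f i)‖ₑ ^ 2 := by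
        refine tsum_congr fun i => ?_
        rw [← hilbertBasis_tsum_sq (onbBasis H)]
        refine tsum_congr fun e => ?_
        rw [← adjoint_inner_left, isSelfAdjoint_sqrt, enorm_inner_symm]
    _ = _ := by simp only [ofReal_re_inner_self hS']

theorem tsum_enorm_sq_proj_le {ι : Type*} {f : ι → H} {a : H}
    (h : HasSum (fun i => ‖inner ℂ (f i) a‖ ^ 2) (‖proj K a‖ ^ 2)) :
    ∑' i, ‖inner ℂ (f i) a‖ₑ ^ 2 ≤ ‖a‖ₑ ^ 2 := by
  rw [tsum_enorm_sq_of_hasSum h, ENNReal.ofReal_pow (norm_nonneg _), ← ofReal_norm]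
  gcongr
  exact norm_proj_apply_le K a

/-- For a positive operator `S` the trace of `P_K S P_K` is determined by Parseval type identities
at countably many vectors. -/
theorem exists_tsum_inner_eq_posTrace {S : H →L[ℂ] H} (hS : S.IsPositive)
    (hc : (onb H).Countable) :
    ∃ D : Set H, D.Countable ∧ ∀ (K : ClosedSubmodule ℂ H) {ι : Type} {f : ι → H},
      (∀ a ∈ D, HasSum (fun i => ‖inner ℂ (f i) a‖ ^ 2) (‖proj K a‖ ^ 2)) →
      posTrace (proj K ∘L S ∘L proj K) =
        ∑' i, ENNReal.ofReal (RCLike.re (inner ℂ (f i) (S (f i)))) := by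
  have : Countable (onb H) := hc.to_subtype
  exact ⟨Set.range fun e => CFC.sqrt S (onbBasis H e), Set.countable_range _,
    fun K _ _ hf => tsum_inner_eq_posTrace hS fun e => hf _ ⟨e, rfl⟩⟩

/-- The projection onto `U⁻¹ K` is `U⁻¹ P_K U`, and `U⁻¹` preserves norms. -/
theorem norm_proj_of_eq_image {K K' : ClosedSubmodule ℂ H} (U : H ≃ₗᵢ[ℂ] H)
    (h : (K' : Set H) = U.symm '' (K : Set H)) (a : H) : ‖proj K' a‖ = ‖proj K (U a)‖ := by
  have h1 : K'.toSubmodule = K.toSubmodule.map (U.symm.toLinearEquiv : H →ₗ[ℂ] H) :=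
    SetLike.coe_injective h
  have h2 : proj K' a = U.symm (proj K (U a)) := by
    simp only [proj, h1]
    exact Submodule.starProjection_map_apply U.symm _ a
  rw [h2, LinearIsometryEquiv.norm_map]

/-- For a trace-class operator `S` the trace of `S P_K` is determined by Parseval type identities
at countably many vectors. -/
theorem IsTraceClass.exists_hasSum_trace {S : H →L[ℂ] H} (hS : IsTraceClass S)
    (hc : (onb H).Countable) :
    ∃ D : Set H, D.Countable ∧ ∀ K : ClosedSubmodule ℂ H, IsTraceClass (S ∘L proj K) ∧
      ∀ {ι : Type} {f : ι → H},
        (∀ a ∈ D, HasSum (fun i => ‖inner ℂ (f i) a‖ ^ 2) (‖proj K a‖ ^ 2)) →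
        HasSum (fun i => inner ℂ (f i) (S (f i))) (trace (S ∘L proj K)) := by
  obtain ⟨A, B, hAB, hA, hB⟩ := hS.exists_factorization
  set b := onbBasis H
  have : Countable (onb H) := hc.to_subtype
  let C : Set ℂ := {1, -1, Complex.I, -Complex.I}
  -- The vectors `B* e` and `A* e` provide the Bessel bounds; the combinations `B* e + c A* e` with
  -- `c ∈ {1, -1, i, -i}` provide the polarized identity.
  refine ⟨⋃ e, ({adjoint B (b e), adjoint A (b e)} ∪
    (fun c : ℂ => adjoint B (b e) + c • adjoint A (b e)) '' C), ?_, fun K => ⟨?_, ?_⟩⟩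
  · have hC : C.Countable := Set.Finite.countable (by simp [C])
    exact Set.countable_iUnion fun e =>
      (Set.Finite.countable (by simp)).union (hC.image _)
  · refine isTraceClass_of_factorization (A := A) (B := B ∘L proj K) (fun x y => hAB _ _) hA ?_
    rw [adjoint_comp, adjoint_proj]
    refine ((ENNReal.tsum_le_tsum fun e => ?_).trans_lt hB.lt_top).ne
    rw [comp_apply]
    simp only [← ofReal_norm]
    gcongr
    exact norm_proj_apply_le K _
  · intro ι f hf
    have hproj : ∀ u v : H, inner ℂ (proj K u) (proj K v) = inner ℂ u (proj K v) := fun u v => by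
      rw [inner_proj_left, proj_proj]
    have h1 : HasSum (fun i => inner ℂ (f i) (S (f i)))
        (∑' e, inner ℂ (adjoint B (b e)) (proj K (adjoint A (b e)))) := by
      refine hasSum_inner_of_hilbertSchmidt b hAB hA hB
        (fun e => tsum_enorm_sq_proj_le (hf _ (Set.mem_iUnion.2 ⟨e, by simp⟩)))
        (fun e => tsum_enorm_sq_proj_le (hf _ (Set.mem_iUnion.2 ⟨e, by simp⟩))) fun e => ?_
      rw [← hproj]
      exact hasSum_inner_mul_inner_of_sq fun c hc => hf _
        (Set.mem_iUnion.2 ⟨e, Or.inr ⟨c, hc, rfl⟩⟩)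
    -- The same diagonal formula, now for the pair of families `P e` and `e`: it evaluates the trace
    -- of `S P` to the same double sum.
    have h2 : HasSum (fun e => inner ℂ (b e) (S (proj K (b e))))
        (∑' e, inner ℂ (adjoint B (b e)) (proj K (adjoint A (b e)))) := by
      refine hasSum_inner_of_hilbertSchmidt b hAB hA hB (f := fun e => proj K (b e))
        (fun e => ?_) (fun e => ?_) fun e => ?_
      · simp only [inner_proj_left, hilbertBasis_tsum_sq]
        simp only [← ofReal_norm]
        gcongr
        exact norm_proj_apply_le K _
      · simp only [hilbertBasis_tsum_sq, le_refl]
      · rw [← inner_proj_left]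
        simp only [← inner_proj_left, mul_comm (inner ℂ (b _) _)]
        exact b.hasSum_inner_mul_inner _ _
    have h3 : trace (S ∘L proj K) =
        ∑' e, inner ℂ (adjoint B (b e)) (proj K (adjoint A (b e))) := by
      rw [← h2.tsum_eq, trace]
      simp only [b, onbBasis_apply, comp_apply]
    rwa [h3]

theorem isTraceClass_rankOneOp (f : H) : IsTraceClass (rankOneOp f) := by
  rw [IsTraceClass, CFC.abs_of_nonneg _ ((nonneg_iff_isPositive _).2 (isPositive_rankOneOp f)),
    posTrace]
  have h := hilbertBasis_hasSum_sq (onbBasis H) f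
  simp only [inner_rankOneOp, ← onbBasis_apply]
  simp only [RCLike.re_eq_complex_re, Complex.ofReal_re]
  rw [← ENNReal.ofReal_tsum_of_nonneg (fun _ => by positivity) h.summable]
  exact ENNReal.ofReal_lt_top

end Projection

end Abstract

/-! ### Translations become modulations under the Fourier transform on `L²(ℝ)`. -/

section Fourier

theorem memLp_modulation (a : ℝ) :
    MemLp (fun s : ℝ => Complex.exp (-(Complex.I * a * (2 * Real.pi * s)))) ∞
      (volume : Measure ℝ) := by
  refine memLp_top_of_bound (Continuous.aestronglyMeasurable (by fun_prop)) 1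
    (Eventually.of_forall fun s => le_of_eq ?_)
  rw [Complex.norm_exp]
  simp

theorem fourier_compSubConstCLM (a : ℝ) (f : SchwartzMap ℝ ℂ) (s : ℝ) :
    𝓕 (f.compSubConstCLM ℂ a) s = Complex.exp (-(Complex.I * a * (2 * Real.pi * s))) * 𝓕 f s := by
  rw [SchwartzMap.fourier_coe, SchwartzMap.fourier_coe, Real.fourier_real_eq_integral_exp_smul,
    Real.fourier_real_eq_integral_exp_smul, ← integral_const_mul,
    ← integral_add_right_eq_self _ a]
  refine integral_congr_ae (Eventually.of_forall fun x => ?_)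
  simp only [SchwartzMap.compSubConstCLM_apply, smul_eq_mul, add_sub_cancel_right]
  rw [← mul_assoc, ← Complex.exp_add]
  congr 2
  push_cast
  ring

/-- The Fourier transform on `L²(ℝ)` turns translations into modulations. -/
theorem fourier_translate (a : ℝ) (f : Lp ℂ 2 (volume : Measure ℝ)) :
    (𝓕 (Lp.compMeasurePreserving (fun x : ℝ => x - a) (measurePreserving_sub_right volume a) f) :
      Lp ℂ 2 (volume : Measure ℝ)) =ᵐ[volume]
      fun s => Complex.exp (-(Complex.I * a * (2 * Real.pi * s))) * (𝓕 f : Lp ℂ 2 volume) s := by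
  -- Multiplication by the unimodular character as a bounded operator on `L²`: both sides are then
  -- continuous in `f`, and Schwartz functions suffice by density.
  let M : Lp ℂ 2 (volume : Measure ℝ) →L[ℂ] Lp ℂ 2 (volume : Measure ℝ) :=
    (ContinuousLinearMap.mul ℂ ℂ).holderL volume ∞ 2 2 (memLp_modulation a).toLp
  have hM : ∀ g : Lp ℂ 2 (volume : Measure ℝ), M g =ᵐ[volume]
      fun s => Complex.exp (-(Complex.I * a * (2 * Real.pi * s))) * g s := fun g => by
    filter_upwards [(ContinuousLinearMap.mul ℂ ℂ).coeFn_holder (r := 2) (memLp_modulation a).toLp g,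
      (memLp_modulation a).coeFn_toLp] with s h1 h2
    refine h1.trans ?_
    rw [h2]
    rfl
  have key : 𝓕 (Lp.compMeasurePreserving (fun x : ℝ => x - a)
      (measurePreserving_sub_right volume a) f) = M (𝓕 f) := by
    refine DenseRange.induction_on (p := fun f : Lp ℂ 2 (volume : Measure ℝ) =>
        𝓕 (Lp.compMeasurePreserving (fun x : ℝ => x - a)
          (measurePreserving_sub_right volume a) f) = M (𝓕 f))
      (SchwartzMap.denseRange_toLpCLM (F := ℂ) (μ := (volume : Measure ℝ)) (p := 2)
        ENNReal.ofNat_ne_top) f ?_ fun g => ?_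
    · exact isClosed_eq ((Lp.fourierTransformₗᵢ ℝ ℂ).continuous.comp
        (Lp.isometry_compMeasurePreserving _).continuous)
        (M.continuous.comp (Lp.fourierTransformₗᵢ ℝ ℂ).continuous)
    · have h1 : Lp.compMeasurePreserving (fun x : ℝ => x - a) (measurePreserving_sub_right volume a)
          (g.toLp 2) = (g.compSubConstCLM ℂ a).toLp 2 := rfl
      change 𝓕 (Lp.compMeasurePreserving (fun x : ℝ => x - a) (measurePreserving_sub_right volume a)
          (g.toLp 2)) = M (𝓕 (g.toLp 2))
      rw [h1, SchwartzMap.toLp_fourier_eq, SchwartzMap.toLp_fourier_eq]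
      refine Lp.ext ?_
      filter_upwards [hM ((𝓕 g).toLp 2), (𝓕 (g.compSubConstCLM ℂ a)).coeFn_toLp 2 volume,
        (𝓕 g).coeFn_toLp 2 volume] with s h2 h3 h4
      rw [h2, h3, h4, fourier_compSubConstCLM]
  rw [key]
  exact hM _

theorem fourier_shift {n : ℕ} (θ : Fin n → ℝ) (k : ℤ) (φ : L2n n) (j : Fin n) :
    ∀ᵐ s : ℝ, (𝓕 (shift θ k φ j) : Lp ℂ 2 (volume : Measure ℝ)) s =
      Complex.exp (-(Complex.I * k * (2 * Real.pi * s + θ j))) *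
        (𝓕 (φ j) : Lp ℂ 2 (volume : Measure ℝ)) s := by
  have h : (𝓕 (shift θ k φ j) : Lp ℂ 2 (volume : Measure ℝ)) =
      Complex.exp (-(Complex.I * (k : ℂ) * (θ j : ℂ))) •
        𝓕 (Lp.compMeasurePreserving (fun x : ℝ => x - (k : ℝ))
          (measurePreserving_sub_right volume (k : ℝ)) (φ j)) :=
    (Lp.fourierTransformₗᵢ ℝ ℂ).map_smul _ _
  rw [h]
  filter_upwards [Lp.coeFn_smul (Complex.exp (-(Complex.I * (k : ℂ) * (θ j : ℂ))))
    (𝓕 (Lp.compMeasurePreserving (fun x : ℝ => x - (k : ℝ))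
          (measurePreserving_sub_right volume (k : ℝ)) (φ j))), fourier_translate k (φ j)]
    with s h1 h2
  rw [h1, Pi.smul_apply, h2, smul_eq_mul, ← mul_assoc, ← Complex.exp_add]
  congr 2
  push_cast
  ring

end Fourier

/-! ### Periodization of integrals over the line to the unit interval. -/

section Periodization

/-- Lebesgue measure on the unit interval. -/
noncomputable abbrev unitMeasure : Measure ℝ := volume.restrict (Set.Ico 0 1)

theorem measurableEmbedding_translate (c d : ℝ) :
    MeasurableEmbedding (fun t : ℝ => t - c + d) :=
  (measurableEmbedding_addRight d).comp (MeasurableEquiv.subRight c).measurableEmbedding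

/-- The intervals `[k - c, k - c + 1)` tile the line. The offset `c` will be `θ_j / 2π`, so that all
components `j` share one unit interval for `t`. -/
theorem volume_eq_sum_map (c : ℝ) : (volume : Measure ℝ) =
    Measure.sum fun k : ℤ => unitMeasure.map (fun t => t - c + (k : ℝ)) := by
  conv_lhs => rw [← Measure.restrict_univ (μ := (volume : Measure ℝ)),
    ← iUnion_Ico_add_intCast (-c),
    Measure.restrict_iUnion (Set.pairwise_disjoint_Ico_add_intCast (-c))
      (fun _ => measurableSet_Ico)]
  congr 1
  ext1 k
  have h : MeasurePreserving (fun t : ℝ => t - c + (k : ℝ)) volume volume :=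
    (measurePreserving_add_right volume (k : ℝ)).comp (measurePreserving_sub_right volume c)
  have h2 := h.restrict_preimage (measurableSet_Ico (a := -c + (k : ℝ)) (b := -c + k + 1))
  rw [← h2.map_eq, unitMeasure]
  congr 2
  ext t
  simp only [Set.mem_preimage, Set.mem_Ico]
  constructor <;> rintro ⟨h3, h4⟩ <;> constructor <;> linarith

theorem ae_iff_ae_unitMeasure (c : ℝ) {p : ℝ → Prop} :
    (∀ᵐ s : ℝ, p s) ↔ ∀ᵐ t ∂unitMeasure, ∀ k : ℤ, p (t - c + k) := by
  conv_lhs => rw [volume_eq_sum_map c]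
  rw [Measure.ae_sum_iff, ae_all_iff]
  exact forall_congr' fun k => (measurableEmbedding_translate c k).ae_map_iff

theorem quasiMeasurePreserving_translate (c : ℝ) (k : ℤ) :
    Measure.QuasiMeasurePreserving (fun t : ℝ => t - c + (k : ℝ)) unitMeasure volume :=
  ⟨by fun_prop, by
    conv_rhs => rw [volume_eq_sum_map c]
    exact (Measure.le_sum _ k).absolutelyContinuous⟩

theorem lintegral_eq_lintegral_tsum (c : ℝ) {F : ℝ → ℝ≥0∞} (hF : AEMeasurable F) :
    ∫⁻ s, F s = ∫⁻ t, ∑' k : ℤ, F (t - c + k) ∂unitMeasure := by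
  have hm : ∀ k : ℤ, AEMeasurable (fun t => F (t - c + k)) unitMeasure := fun k =>
    hF.comp_quasiMeasurePreserving (quasiMeasurePreserving_translate c k)
  rw [lintegral_tsum hm]
  conv_lhs => rw [volume_eq_sum_map c, lintegral_sum_measure]
  exact tsum_congr fun k => (measurableEmbedding_translate c k).lintegral_map _

theorem integrable_tsum_and_integral_eq (c : ℝ) {F : ℝ → ℂ} (hF : Integrable F) :
    Integrable (fun t => ∑' k : ℤ, F (t - c + k)) unitMeasure ∧
      ∫ s, F s = ∫ t, ∑' k : ℤ, F (t - c + k) ∂unitMeasure := by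
  have hm : ∀ k : ℤ, AEStronglyMeasurable (fun t => F (t - c + k)) unitMeasure := fun k =>
    hF.1.comp_quasiMeasurePreserving (quasiMeasurePreserving_translate c k)
  have hfin : ∫⁻ t, ∑' k : ℤ, ‖F (t - c + k)‖ₑ ∂unitMeasure < ∞ := by
    rw [← lintegral_eq_lintegral_tsum c hF.1.enorm]
    exact hF.2
  refine ⟨⟨(AEMeasurable.tsum fun k => (hm k).aemeasurable).aestronglyMeasurable,
    (lintegral_mono fun t => ?_).trans_lt hfin⟩, ?_⟩
  · exact enorm_tsum_le_tsum_enorm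
  · rw [integral_tsum hm (by rw [← lintegral_tsum fun k => (hm k).enorm]; exact hfin.ne)]
    have hF' := hF
    rw [volume_eq_sum_map c] at hF'
    conv_lhs => rw [volume_eq_sum_map c, integral_sum_measure hF']
    exact tsum_congr fun k => (measurableEmbedding_translate c k).integral_map _

/-- Parseval's identity on the unit interval. -/
theorem hasSum_sq_integral_exp {h : ℝ → ℂ} (hh : MemLp h 2 unitMeasure) :
    HasSum (fun k : ℤ =>
        ‖∫ t, Complex.exp (-(2 * Real.pi * Complex.I * k * t)) * h t ∂unitMeasure‖ ^ 2)
      (∫ t, ‖h t‖ ^ 2 ∂unitMeasure) := by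
  have hμ : (volume : Measure ℝ).restrict (Set.Ioc 0 1) = unitMeasure :=
    Measure.restrict_congr_set Ico_ae_eq_Ioc.symm
  have h1 := hasSum_sq_fourierCoeffOn (f := h) (zero_lt_one (α := ℝ)) (by rwa [hμ])
  simp only [fourierCoeffOn_eq_integral, intervalIntegral.integral_of_le zero_le_one, hμ] at h1
  simpa [fourier_coe_apply, -fourier_apply, fourier_neg] using h1

end Periodization

/-! ### Fibers: square summability, Fourier coefficients of inner products, surjectivity and
periodicity. -/

section Fiber

theorem hat_two_pi_mul (f : Lp ℂ 2 (volume : Measure ℝ)) (x t : ℝ) (k : ℤ) :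
    hat f (2 * Real.pi * t - x + 2 * k * Real.pi) =
      (𝓕 f : Lp ℂ 2 (volume : Measure ℝ)) (t - x / (2 * Real.pi) + k) := by
  rw [hat]
  congr 1
  field_simp

theorem l2_tsum_enorm_sq (x : L2Z) : ∑' k, ‖x k‖ₑ ^ 2 = ‖x‖ₑ ^ 2 := by
  have h := Complex.hasSum_re (lp.hasSum_inner x x)
  have h1 : (inner ℂ x x).re = ‖x‖ ^ 2 := inner_self_eq_norm_sq (𝕜 := ℂ) x
  have h2 : ∀ k, (inner ℂ (x k) (x k)).re = ‖x k‖ ^ 2 := fun k =>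
    inner_self_eq_norm_sq (𝕜 := ℂ) (x k)
  simp only [h1, h2] at h
  rw [tsum_enorm_sq_of_hasSum h, ENNReal.ofReal_pow (norm_nonneg _), ofReal_norm]

theorem memℓp_of_tsum_enorm_sq {x : ℤ → ℂ} (h : ∑' k, ‖x k‖ₑ ^ 2 ≠ ∞) : Memℓp x 2 :=
  memℓp_gen (by simpa using summable_norm_sq_of_tsum_enorm_sq h)

theorem lintegral_enorm_sq_lt_top (f : Lp ℂ 2 (volume : Measure ℝ)) :
    ∫⁻ s, ‖f s‖ₑ ^ 2 < ∞ := by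
  have h := lintegral_rpow_enorm_lt_top_of_eLpNorm_lt_top (p := 2) (by simp) (by simp)
    (Lp.memLp f).2
  simpa using h

/-- The periodization of `|𝓕 φ_j|²` has finite integral, hence is finite a.e.; thus the default
value `0` in `fiber₁` is taken only on a null set. -/
theorem fiber_apply_ae {n : ℕ} (θ : Fin n → ℝ) (φ : L2n n) :
    ∀ᵐ t ∂unitMeasure, ∀ j k, fiber θ φ (2 * Real.pi * t) j k =
      (𝓕 (φ j) : Lp ℂ 2 (volume : Measure ℝ)) (t - θ j / (2 * Real.pi) + k) := by
  refine ae_all_iff.2 fun j => ?_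
  set F : Lp ℂ 2 (volume : Measure ℝ) := 𝓕 (φ j)
  have hF : AEMeasurable (fun s => ‖F s‖ₑ ^ 2) :=
    (Lp.aestronglyMeasurable F).enorm.pow_const 2
  have h1 : ∫⁻ t, ∑' k : ℤ, ‖F (t - θ j / (2 * Real.pi) + k)‖ₑ ^ 2 ∂unitMeasure ≠ ∞ := by
    rw [← lintegral_eq_lintegral_tsum _ hF]
    exact (lintegral_enorm_sq_lt_top F).ne
  have hm : ∀ k : ℤ, AEMeasurable
      (fun t => ‖F (t - θ j / (2 * Real.pi) + k)‖ₑ ^ 2) unitMeasure := fun k =>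
    hF.comp_quasiMeasurePreserving (quasiMeasurePreserving_translate _ k)
  filter_upwards [ae_lt_top' (AEMeasurable.tsum hm) h1] with t ht k
  have h2 : Memℓp (fun k : ℤ => hat (φ j) (2 * Real.pi * t - θ j + 2 * k * Real.pi)) 2 := by
    simp only [hat_two_pi_mul]
    exact memℓp_of_tsum_enorm_sq ht.ne
  have h3 : fiber θ φ (2 * Real.pi * t) j = ⟨_, h2⟩ := by
    simp only [fiber, fiber₁, dif_pos h2]
  rw [h3]
  exact hat_two_pi_mul _ _ _ _

theorem inner_L2Zn {n : ℕ} (x y : L2Zn n) :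
    inner ℂ x y = ∑ j, ∑' k, inner ℂ (x j k) (y j k) := by
  rw [PiLp.inner_apply]
  simp only [lp.inner_eq_tsum]

/-- The phase `exp(-i k θ_j)` in the translation cancels the offset `θ_j / 2π` of the fiber, and the
integer `m` contributes a full period. The resulting character depends on neither `j` nor `m`, so it
factors out of the inner product of fibers. -/
theorem exp_two_pi_int_mul (k m : ℤ) (t x : ℝ) :
    Complex.exp (-(Complex.I * k * (2 * Real.pi * ((t - x / (2 * Real.pi) + m : ℝ) : ℂ) + x))) =
      Complex.exp (-(2 * Real.pi * Complex.I * k * t)) := by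
  have hpi : (Real.pi : ℂ) ≠ 0 := by exact_mod_cast Real.pi_ne_zero
  have h : -(Complex.I * k * (2 * Real.pi * ((t - x / (2 * Real.pi) + m : ℝ) : ℂ) + x)) =
      -(2 * Real.pi * Complex.I * k * t) + ((-(k * m) : ℤ) : ℂ) * (2 * Real.pi * Complex.I) := by
    push_cast
    field_simp
    ring
  rw [h, Complex.exp_add, Complex.exp_int_mul_two_pi_mul_I, mul_one]

/-- Inner products with translates are Fourier coefficients of the inner products of fibers. -/
theorem inner_shift {n : ℕ} (θ : Fin n → ℝ) (f g : L2n n) (k : ℤ) :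
    Integrable (fun t : ℝ => Complex.exp (-(2 * Real.pi * Complex.I * k * t)) *
        inner ℂ (fiber θ f (2 * Real.pi * t)) (fiber θ g (2 * Real.pi * t))) unitMeasure ∧
      inner ℂ f (shift θ k g) = ∫ t : ℝ, Complex.exp (-(2 * Real.pi * Complex.I * k * t)) *
        inner ℂ (fiber θ f (2 * Real.pi * t)) (fiber θ g (2 * Real.pi * t)) ∂unitMeasure := by
  let F : Fin n → ℝ → ℂ := fun j s =>
    inner ℂ ((𝓕 (f j) : Lp ℂ 2 (volume : Measure ℝ)) s)
      ((𝓕 (shift θ k g j) : Lp ℂ 2 (volume : Measure ℝ)) s)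
  have hF : ∀ j, Integrable (F j) := fun j => L2.integrable_inner _ _
  have hper := fun j => integrable_tsum_and_integral_eq (θ j / (2 * Real.pi)) (hF j)
  have hae : ∀ᵐ t ∂unitMeasure, ∑ j, ∑' m : ℤ, F j (t - θ j / (2 * Real.pi) + m) =
      Complex.exp (-(2 * Real.pi * Complex.I * k * t)) *
        inner ℂ (fiber θ f (2 * Real.pi * t)) (fiber θ g (2 * Real.pi * t)) := by
    have hs := ae_all_iff.2 fun j =>
      (ae_iff_ae_unitMeasure (θ j / (2 * Real.pi))).1 (fourier_shift θ k g j)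
    filter_upwards [fiber_apply_ae θ f, fiber_apply_ae θ g, hs] with t h1 h2 h3
    rw [inner_L2Zn, Finset.mul_sum]
    refine Finset.sum_congr rfl fun j _ => ?_
    rw [← tsum_mul_left]
    refine tsum_congr fun m => ?_
    rw [h1, h2]
    simp only [F]
    rw [h3, exp_two_pi_int_mul, RCLike.inner_apply, RCLike.inner_apply, mul_assoc]
  refine ⟨(integrable_finsetSum _ fun j _ => (hper j).1).congr hae, ?_⟩
  rw [← integral_congr_ae hae, integral_finsetSum _ fun j _ => (hper j).1, PiLp.inner_apply]
  refine Finset.sum_congr rfl fun j _ => ?_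
  rw [← Lp.inner_fourier_eq, L2.inner_def, (hper j).2]

theorem shift_zero {n : ℕ} (θ : Fin n → ℝ) (f g : L2n n) :
    inner ℂ f (shift θ 0 g) = inner ℂ f g := by
  have h : ∀ j, (𝓕 (shift θ 0 g j) : Lp ℂ 2 (volume : Measure ℝ)) = 𝓕 (g j) := fun j => by
    refine Lp.ext ?_
    filter_upwards [fourier_shift θ 0 g j] with s hs
    rw [hs]
    simp
  rw [PiLp.inner_apply, PiLp.inner_apply]
  refine Finset.sum_congr rfl fun j _ => ?_
  rw [← Lp.inner_fourier_eq, h, Lp.inner_fourier_eq]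

theorem integrable_inner_fiber {n : ℕ} (θ : Fin n → ℝ) (f g : L2n n) :
    Integrable (fun t => inner ℂ (fiber θ f (2 * Real.pi * t)) (fiber θ g (2 * Real.pi * t)))
      unitMeasure := by
  simpa using (inner_shift θ f g 0).1

theorem integrable_norm_sq_fiber {n : ℕ} (θ : Fin n → ℝ) (f : L2n n) :
    Integrable (fun t => ‖fiber θ f (2 * Real.pi * t)‖ ^ 2) unitMeasure := by
  have h : ∀ t, ‖fiber θ f (2 * Real.pi * t)‖ ^ 2 =
      RCLike.re (inner ℂ (fiber θ f (2 * Real.pi * t)) (fiber θ f (2 * Real.pi * t))) :=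
    fun t => (inner_self_eq_norm_sq (𝕜 := ℂ) _).symm
  simp only [h]
  exact (integrable_inner_fiber θ f f).re

theorem norm_sq_eq_integral_fiber {n : ℕ} (θ : Fin n → ℝ) (f : L2n n) :
    ‖f‖ ^ 2 = ∫ t, ‖fiber θ f (2 * Real.pi * t)‖ ^ 2 ∂unitMeasure := by
  have h := (inner_shift θ f f 0).2
  rw [shift_zero, inner_self_eq_norm_sq_to_K] at h
  simp only [Int.cast_zero, mul_zero, zero_mul, neg_zero, Complex.exp_zero, one_mul,
    inner_self_eq_norm_sq_to_K] at h
  have h2 := (integral_ofReal (𝕜 := ℂ) (μ := unitMeasure)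
    (f := fun t => ‖fiber θ f (2 * Real.pi * t)‖ ^ 2))
  push_cast at h2
  have h3 := h.trans h2
  exact_mod_cast h3

/-- Parseval on the unit interval. The inner product of two fibers is in general only integrable;
boundedness of the fibers of `f` makes it square integrable. -/
theorem tsum_enorm_sq_inner_shift {n : ℕ} (θ : Fin n → ℝ) (f g : L2n n) {C : ℝ}
    (hC : ∀ᵐ t ∂unitMeasure, ‖fiber θ f (2 * Real.pi * t)‖ ≤ C) :
    ∑' k : ℤ, ‖inner ℂ f (shift θ k g)‖ₑ ^ 2 =
      ∫⁻ t, ‖inner ℂ (fiber θ f (2 * Real.pi * t)) (fiber θ g (2 * Real.pi * t))‖ₑ ^ 2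
        ∂unitMeasure := by
  set h : ℝ → ℂ := fun t => inner ℂ (fiber θ f (2 * Real.pi * t)) (fiber θ g (2 * Real.pi * t))
  have hm : AEStronglyMeasurable h unitMeasure := (integrable_inner_fiber θ f g).1
  have hsq : Integrable (fun t => ‖h t‖ ^ 2) unitMeasure := by
    refine Integrable.mono' ((integrable_norm_sq_fiber θ g).const_mul (C ^ 2))
      (hm.norm.pow 2) ?_
    filter_upwards [hC] with t ht
    rw [Real.norm_of_nonneg (by positivity), ← mul_pow]
    gcongr
    exact (norm_inner_le_norm _ _).trans (by gcongr)
  have hp := hasSum_sq_integral_exp ((memLp_two_iff_integrable_sq_norm hm).2 hsq)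
  simp only [h, ← (inner_shift θ f g _).2] at hp
  rw [tsum_enorm_sq_of_hasSum hp,
    ofReal_integral_eq_lintegral_ofReal hsq (Eventually.of_forall fun _ => by positivity)]
  refine lintegral_congr fun t => ?_
  rw [ENNReal.ofReal_pow (norm_nonneg _), ofReal_norm]

/-- Bounded measurable fields on the unit interval are fibers of square integrable functions. -/
theorem exists_fiber_eq {n : ℕ} (θ : Fin n → ℝ) {v : ℝ → L2Zn n} {C : ℝ} (hC : ∀ t, ‖v t‖ ≤ C)
    (hv : ∀ j k, AEMeasurable (fun t => v t j k) unitMeasure) :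
    ∃ f : L2n n, ∀ᵐ t ∂unitMeasure, fiber θ f (2 * Real.pi * t) = v t := by
  -- The Fourier transform is glued from the coordinates: on the `k`-th cell, `F j` is a measurable
  -- representative of the `(j, k)` coordinate of `v`.
  let G : Fin n → ℤ → ℝ → ℂ := fun j k => (hv j k).mk
  let F : Fin n → ℝ → ℂ := fun j s =>
    G j ⌊s + θ j / (2 * Real.pi)⌋ (Int.fract (s + θ j / (2 * Real.pi)))
  have hFG : ∀ᵐ t ∂unitMeasure, ∀ j (k : ℤ), F j (t - θ j / (2 * Real.pi) + k) = v t j k := by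
    have h := ae_all_iff.2 fun j => ae_all_iff.2 fun k => (hv j k).ae_eq_mk
    filter_upwards [h, ae_restrict_mem measurableSet_Ico] with t ht htm j k
    have h1 : t - θ j / (2 * Real.pi) + k + θ j / (2 * Real.pi) = t + k := by ring
    simp only [F, G, h1, Int.floor_add_intCast, Int.fract_add_intCast,
      Int.floor_eq_zero_iff.2 htm, Int.fract_eq_self.2 htm, zero_add]
    exact (ht j k).symm
  have hFm : ∀ j, Measurable (F j) := fun j => by
    have h1 : Measurable (fun p : ℤ × ℝ => G j p.1 p.2) :=
      measurable_from_prod_countable_right fun k => (hv j k).measurable_mk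
    exact h1.comp ((Int.measurable_floor.comp (measurable_id.add_const _)).prodMk
      (measurable_fract.comp (measurable_id.add_const _)))
  have hF : ∀ j, MemLp (F j) 2 := fun j => by
    refine ⟨(hFm j).aestronglyMeasurable, ?_⟩
    rw [eLpNorm_lt_top_iff_lintegral_rpow_enorm_lt_top (by simp) (by simp)]
    have h1 : ∫⁻ s, ‖F j s‖ₑ ^ 2 ≤ ∫⁻ _, ENNReal.ofReal C ^ 2 ∂unitMeasure := by
      rw [lintegral_eq_lintegral_tsum (θ j / (2 * Real.pi)) ((hFm j).enorm.pow_const 2).aemeasurable]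
      refine lintegral_mono_ae ?_
      filter_upwards [hFG] with t ht
      simp only [ht, l2_tsum_enorm_sq]
      gcongr
      rw [← ofReal_norm]
      exact ENNReal.ofReal_le_ofReal ((PiLp.norm_apply_le (v t) j).trans (hC t))
    refine lt_of_le_of_lt (by simpa using h1) ?_
    simp
  refine ⟨WithLp.toLp 2 fun j => 𝓕⁻ ((hF j).toLp), ?_⟩
  have h2 : ∀ᵐ t ∂unitMeasure, ∀ j (k : ℤ),
      ((hF j).toLp : Lp ℂ 2 (volume : Measure ℝ)) (t - θ j / (2 * Real.pi) + k) =
        F j (t - θ j / (2 * Real.pi) + k) :=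
    ae_all_iff.2 fun j => (ae_iff_ae_unitMeasure _).1 (hF j).coeFn_toLp
  filter_upwards [fiber_apply_ae θ (WithLp.toLp 2 fun j => 𝓕⁻ ((hF j).toLp)), hFG, h2]
    with t h3 h4 h5
  ext j k
  rw [h3, ← h4, ← h5]
  simp only [FourierTransform.fourier_fourierInv_eq]

/-- Reindexing preserves square summability in both directions, so the identity holds at every `ξ`,
the exceptional ones included. -/
theorem fiber₁_add (f : Lp ℂ 2 (volume : Measure ℝ)) (ξ : ℝ) (k : ℤ) :
    fiber₁ f (ξ + 2 * k * Real.pi) = (lam₁ k).symm (fiber₁ f ξ) := by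
  have h1 : ∀ m : ℤ, hat f (ξ + 2 * k * Real.pi + 2 * m * Real.pi) =
      hat f (ξ + 2 * ((m - -k : ℤ) : ℝ) * Real.pi) := fun m => by
    congr 1
    push_cast
    ring
  by_cases h : Memℓp (fun m : ℤ => hat f (ξ + 2 * (m : ℝ) * Real.pi)) 2
  · have h' : Memℓp (fun m : ℤ => hat f (ξ + 2 * k * Real.pi + 2 * (m : ℝ) * Real.pi)) 2 := by
      simp only [h1]
      exact memℓp_shift (-k) ⟨_, h⟩
    rw [fiber₁, fiber₁, dif_pos h, dif_pos h']
    ext m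
    exact h1 m
  · have h' : ¬ Memℓp (fun m : ℤ => hat f (ξ + 2 * k * Real.pi + 2 * (m : ℝ) * Real.pi)) 2 := by
      intro h'
      apply h
      have h2 := memℓp_shift k ⟨_, h'⟩
      convert! h2 using 2 with m
      change _ = hat f (ξ + 2 * k * Real.pi + 2 * ((m - k : ℤ) : ℝ) * Real.pi)
      congr 1
      push_cast
      ring
    rw [fiber₁, fiber₁, dif_neg h, dif_neg h', map_zero]

theorem fiber_add {n : ℕ} (θ : Fin n → ℝ) (φ : L2n n) (ξ : ℝ) (k : ℤ) :
    fiber θ φ (ξ + 2 * k * Real.pi) = (lam k).symm (fiber θ φ ξ) := by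
  ext j : 1
  have h : ξ + 2 * k * Real.pi - θ j = ξ - θ j + 2 * k * Real.pi := by ring
  change fiber₁ (φ j) (ξ + 2 * k * Real.pi - θ j) = (lam₁ k).symm (fiber₁ (φ j) (ξ - θ j))
  rw [h, fiber₁_add]

end Fiber

/-! ### Separability and countability of generators. -/

section Countability

/-- Each nonzero `g i` is non-orthogonal to some member of a dense sequence, and each member of the
sequence detects only countably many indices. -/
theorem countable_of_countable_inner_ne_zero {X ι : Type*} [NormedAddCommGroup X]
    [InnerProductSpace ℂ X] [SecondCountableTopology X] {g : ι → X} (hg : ∀ i, g i ≠ 0)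
    (h : ∀ x, {i | inner ℂ x (g i) ≠ 0}.Countable) : Countable ι := by
  rw [← Set.countable_univ_iff]
  refine (Set.countable_iUnion fun m => h (TopologicalSpace.denseSeq X m)).mono fun i _ => ?_
  have ho : IsOpen {x : X | inner ℂ x (g i) ≠ 0} :=
    isOpen_ne_fun (by fun_prop) continuous_const
  obtain ⟨m, hm⟩ := (TopologicalSpace.denseRange_denseSeq X).exists_mem_open ho
    ⟨g i, inner_self_ne_zero.2 (hg i)⟩
  exact Set.mem_iUnion.2 ⟨m, hm⟩

theorem countable_of_summable_norm_sq {ι E : Type*} [NormedAddCommGroup E] {g : ι → E}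
    (h : Summable fun i => ‖g i‖ ^ 2) : {i | g i ≠ 0}.Countable :=
  h.countable_support.mono fun i hi => by simpa using hi

instance : SecondCountableTopology L2Z := by
  have : TopologicalSpace.SeparableSpace L2Z := by
    let b : HilbertBasis ℤ ℂ L2Z := HilbertBasis.ofRepr (LinearIsometryEquiv.refl ℂ L2Z)
    have h1 : TopologicalSpace.IsSeparable (Set.range b) :=
      (Set.countable_range b).isSeparable
    have h2 := (h1.span (R := ℂ)).closure
    rw [← Submodule.topologicalClosure_coe, b.dense_span, Submodule.top_coe] at h2
    exact TopologicalSpace.isSeparable_univ_iff.1 h2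
  exact UniformSpace.secondCountable_of_separable L2Z

theorem countable_onb {H : Type*} [NormedAddCommGroup H] [InnerProductSpace ℂ H] [CompleteSpace H]
    [SecondCountableTopology H] : (onb H).Countable :=
  countable_of_countable_inner_ne_zero (g := onbBasis H)
    (fun e => (onbBasis H).orthonormal.ne_zero e) fun x => by
      refine (countable_of_summable_norm_sq (hilbertBasis_hasSum_sq (onbBasis H) x).summable).mono
        fun e he => ?_
      rwa [Set.mem_ofPred_eq, ne_eq, inner_eq_zero_symm] at he

theorem IsNTFGenerator.countable {n : ℕ} {θ : Fin n → ℝ} {V : ClosedSubmodule ℂ (L2n n)}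
    {Φ : Set (L2n n)} (hΦ : IsNTFGenerator θ V Φ) : Φ.Countable := by
  have : Fact ((2 : ℝ≥0∞) ≠ ∞) := ⟨ENNReal.ofNat_ne_top⟩
  have h : (Φ \ {0}).Countable := by
    -- The ambient space is `V`, since the frame identity is available only for `f ∈ V`. The terms
    -- with `k = 0` suffice.
    refine countable_of_countable_inner_ne_zero (X := V.toSubmodule)
      (g := fun φ : (Φ \ {0} : Set (L2n n)) => ⟨(φ : L2n n), hΦ.1 _ φ.2.1⟩)
      (fun φ h0 => φ.2.2 (congrArg Subtype.val h0)) fun x => ?_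
    have h1 := countable_of_summable_norm_sq (hΦ.2.2 x x.2).summable
    refine Set.Countable.preimage_of_injOn
      (f := fun φ : (Φ \ {0} : Set (L2n n)) => ((0 : ℤ), (⟨φ, φ.2.1⟩ : Φ))) h1 ?_ |>.mono ?_
    · intro φ _ ψ _ h
      simpa [Subtype.ext_iff] using h
    · intro φ hφ
      simpa [shift_zero] using hφ
  exact (h.union (Set.countable_singleton 0)).mono (by simp)

end Countability

/-! ### The fiberwise Parseval identity and the trace formulas. -/

section RangeFunction

variable {n : ℕ}

theorem quasiMeasurePreserving_mul_left {a : ℝ} (ha : a ≠ 0) :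
    Measure.QuasiMeasurePreserving (fun x : ℝ => a * x) volume volume :=
  ⟨by fun_prop, by
    rw [Real.map_volume_mul_left ha]
    exact Measure.smul_absolutelyContinuous⟩

theorem ae_of_ae_unitMeasure {p : ℝ → Prop}
    (h : ∀ᵐ t ∂unitMeasure, ∀ k : ℤ, p (2 * Real.pi * t + 2 * k * Real.pi)) : ∀ᵐ ξ : ℝ, p ξ := by
  have hpi : (2 * Real.pi) ≠ 0 := by positivity
  have h1 : ∀ᵐ s : ℝ, p (2 * Real.pi * s) := by
    refine (ae_iff_ae_unitMeasure 0).2 (h.mono fun t ht k => ?_)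
    convert! ht k using 1
    ring
  have h2 := (quasiMeasurePreserving_mul_left (inv_ne_zero hpi)).ae h1
  refine h2.mono fun ξ hξ => ?_
  rwa [mul_inv_cancel_left₀ hpi] at hξ

theorem quasiMeasurePreserving_two_pi_mul :
    Measure.QuasiMeasurePreserving (fun t : ℝ => 2 * Real.pi * t) unitMeasure volume :=
  (quasiMeasurePreserving_mul_left (by positivity)).mono_left
    Measure.restrict_le_self.absolutelyContinuous

theorem ae_unitMeasure_of_ae {p : ℝ → Prop} (h : ∀ᵐ ξ : ℝ, p ξ) :
    ∀ᵐ t ∂unitMeasure, p (2 * Real.pi * t) :=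
  quasiMeasurePreserving_two_pi_mul.ae h

/-- The standard basis vectors of `ℓ²(ℤ)ⁿ`. -/
noncomputable def stdVec (j : Fin n) (k : ℤ) : L2Zn n :=
  WithLp.toLp 2 (Pi.single j (lp.single 2 k 1))

theorem inner_stdVec (x : L2Zn n) (j : Fin n) (k : ℤ) :
    inner ℂ (stdVec j k) x = x j k := by
  rw [PiLp.inner_apply, Finset.sum_eq_single j]
  · simp [stdVec, lp.inner_single_left]
  · intro i _ hi
    simp [stdVec, hi]
  · simp

variable {J : ℝ → ClosedSubmodule ℂ (L2Zn n)}

theorem IsPeriodicRangeFunction.mem_add (hJ : IsPeriodicRangeFunction J) {ξ : ℝ} {x : L2Zn n}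
    (hx : x ∈ J ξ) (k : ℤ) : (lam k).symm x ∈ J (ξ + 2 * k * Real.pi) := by
  rw [← SetLike.mem_coe, hJ.periodic k ξ]
  exact ⟨x, hx, rfl⟩

theorem IsPeriodicRangeFunction.norm_proj_add (hJ : IsPeriodicRangeFunction J) (ξ : ℝ) (k : ℤ)
    (a : L2Zn n) : ‖proj (J (ξ + 2 * k * Real.pi)) a‖ = ‖proj (J ξ) (lam k a)‖ :=
  norm_proj_of_eq_image (lam k) (hJ.periodic k ξ) a

theorem IsPeriodicRangeFunction.aemeasurable_inner (hJ : IsPeriodicRangeFunction J)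
    (a b : L2Zn n) :
    AEMeasurable (fun t => inner ℂ (proj (J (2 * Real.pi * t)) a) b) unitMeasure :=
  (hJ.measurable a b).comp_quasiMeasurePreserving quasiMeasurePreserving_two_pi_mul

variable {θ : Fin n → ℝ} {V : ClosedSubmodule ℂ (L2n n)} {Φ : Set (L2n n)}

/-- On the unit interval the constant field `a` is itself a field of fibers, so measurability comes
from the integrability of inner products of two fibers. -/
theorem aemeasurable_inner_fiber (θ : Fin n → ℝ) (φ : L2n n) (a : L2Zn n) :
    AEMeasurable (fun t => inner ℂ (fiber θ φ (2 * Real.pi * t)) a) unitMeasure := by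
  obtain ⟨f, hf⟩ := exists_fiber_eq θ (v := fun _ => a) (fun _ => le_rfl)
    fun j k => aemeasurable_const
  refine (integrable_inner_fiber θ φ f).1.aemeasurable.congr ?_
  filter_upwards [hf] with t ht
  rw [ht]

/-- The range function, applied to a fixed vector and cut off, is the field of fibers of an
element of `V`. -/
theorem IsRangeFunctionOf.exists_mem_fiber_eq (hJ : IsRangeFunctionOf θ V J) (a : L2Zn n)
    {E : Set ℝ} (hE : MeasurableSet E) :
    ∃ f ∈ V, ∀ᵐ t ∂unitMeasure, fiber θ f (2 * Real.pi * t) =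
      E.indicator (fun t => proj (J (2 * Real.pi * t)) a) t := by
  obtain ⟨f, hf⟩ := exists_fiber_eq θ (C := ‖a‖)
    (v := E.indicator (fun t => proj (J (2 * Real.pi * t)) a))
    (fun t => (norm_indicator_le_norm_self _ t).trans (norm_proj_apply_le _ a)) fun j k => by
      have h1 : AEMeasurable (fun t => inner ℂ (stdVec j k) (proj (J (2 * Real.pi * t)) a))
          unitMeasure := by
        refine (Complex.continuous_conj.measurable.comp_aemeasurable
          (hJ.aemeasurable_inner a (stdVec j k))).congr (Eventually.of_forall fun t => ?_)
        exact inner_conj_symm _ _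
      refine (h1.indicator hE).congr (Eventually.of_forall fun t => ?_)
      by_cases ht : t ∈ E <;> simp [ht, inner_stdVec]
  refine ⟨f, (hJ.mem_iff f).2 (ae_of_ae_unitMeasure ?_), hf⟩
  filter_upwards [hf] with t ht k
  rw [fiber_add]
  refine hJ.mem_add ?_ k
  rw [ht]
  by_cases htE : t ∈ E
  · rw [Set.indicator_of_mem htE]
    exact Submodule.starProjection_apply_mem _ a
  · rw [Set.indicator_of_notMem htE]
    exact (J _).toSubmodule.zero_mem

/-- The fibers of a normalized tight frame generator satisfy Parseval's identity on the unit
interval. -/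
theorem IsNTFGenerator.ae_unitMeasure_hasSum (hJ : IsRangeFunctionOf θ V J)
    (hΦ : IsNTFGenerator θ V Φ) (a : L2Zn n) :
    ∀ᵐ t ∂unitMeasure, HasSum (fun φ : Φ => ‖inner ℂ (fiber θ φ (2 * Real.pi * t)) a‖ ^ 2)
      (‖proj (J (2 * Real.pi * t)) a‖ ^ 2) := by
  have : Countable Φ := hΦ.countable.to_subtype
  set g : ℝ → ℝ≥0∞ := fun t => ∑' φ : Φ, ‖inner ℂ (fiber θ φ (2 * Real.pi * t)) a‖ₑ ^ 2 with hg
  set h : ℝ → ℝ≥0∞ := fun t => ENNReal.ofReal (‖proj (J (2 * Real.pi * t)) a‖ ^ 2) with hh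
  have hgm : AEMeasurable g unitMeasure :=
    AEMeasurable.tsum fun φ => (aemeasurable_inner_fiber θ φ a).enorm.pow_const 2
  have hhm : AEMeasurable h unitMeasure := by
    have h1 : ∀ t, ‖proj (J (2 * Real.pi * t)) a‖ ^ 2 =
        RCLike.re (inner ℂ (proj (J (2 * Real.pi * t)) a) a) := fun t => by
      rw [← inner_self_eq_norm_sq (𝕜 := ℂ), ← inner_proj_left, proj_proj]
    simp only [hh, h1]
    exact (RCLike.measurable_re.comp_aemeasurable (hJ.aemeasurable_inner a a)).ennreal_ofReal
  have key : g =ᵐ[unitMeasure] h := by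
    -- The integrals over every `E` agree: this is the frame identity for the `f ∈ V` with fibers
    -- `1_E(t) J(2πt) a`, where Parseval has evaluated the sum over `k`.
    refine ae_eq_of_forall_setLIntegral_eq_of_sigmaFinite₀ hgm hhm fun E hE _ => ?_
    obtain ⟨f, hfV, hf⟩ := hJ.exists_mem_fiber_eq a hE
    have hb : ∀ᵐ t ∂unitMeasure, ‖fiber θ f (2 * Real.pi * t)‖ ≤ ‖a‖ := by
      filter_upwards [hf] with t ht
      rw [ht]
      exact (norm_indicator_le_norm_self _ t).trans (norm_proj_apply_le _ a)
    have hmem : ∀ᵐ t ∂unitMeasure, ∀ φ : Φ,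
        fiber θ φ (2 * Real.pi * t) ∈ J (2 * Real.pi * t) :=
      ae_all_iff.2 fun φ => ae_unitMeasure_of_ae ((hJ.mem_iff φ).1 (hΦ.1 φ φ.2))
    have hm : ∀ φ : Φ, AEMeasurable (fun t => ‖inner ℂ (fiber θ f (2 * Real.pi * t))
        (fiber θ φ (2 * Real.pi * t))‖ₑ ^ 2) unitMeasure := fun φ =>
      (integrable_inner_fiber θ f φ).1.enorm.pow_const 2
    have h1 := tsum_enorm_sq_of_hasSum (hΦ.2.2 f hfV)
    rw [ENNReal.tsum_prod', ENNReal.tsum_comm] at h1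
    simp only [tsum_enorm_sq_inner_shift θ f _ hb] at h1
    rw [← lintegral_tsum hm, norm_sq_eq_integral_fiber θ f, ofReal_integral_eq_lintegral_ofReal
      (integrable_norm_sq_fiber θ f) (Eventually.of_forall fun _ => by positivity)] at h1
    rw [← lintegral_indicator hE, ← lintegral_indicator hE]
    refine Eq.trans (lintegral_congr_ae ?_) (h1.trans (lintegral_congr_ae ?_))
    · filter_upwards [hf, hmem] with t ht htm
      rw [ht]
      by_cases hE : t ∈ E
      · simp only [Set.indicator_of_mem hE, hg]
        -- As the fiber of `φ` lies in `J(2πt)`, the projection moved onto it disappears.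
        refine tsum_congr fun φ => ?_
        rw [inner_proj_left, proj, Submodule.starProjection_eq_self_iff.2 (htm φ),
          enorm_inner_symm]
      · simp [Set.indicator_of_notMem hE]
    · filter_upwards [hf] with t ht
      rw [ht]
      by_cases hE : t ∈ E
      · simp only [Set.indicator_of_mem hE, hh]
      · simp [Set.indicator_of_notMem hE]
  filter_upwards [key] with t ht
  exact hasSum_norm_sq_of_tsum_enorm_sq (by positivity) ht

/-- For almost every `ξ` the fibers of a normalized tight frame generator satisfy Parseval's
identity at a given vector. -/
theorem IsNTFGenerator.ae_hasSum (hJ : IsRangeFunctionOf θ V J) (hΦ : IsNTFGenerator θ V Φ)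
    (a : L2Zn n) :
    ∀ᵐ ξ : ℝ, HasSum (fun φ : Φ => ‖inner ℂ (fiber θ φ ξ) a‖ ^ 2) (‖proj (J ξ) a‖ ^ 2) := by
  -- At `ξ = 2πt + 2kπ` both sides are those at `2πt` with `a` replaced by `λ(k) a`; only countably
  -- many `k` occur.
  refine ae_of_ae_unitMeasure
    ((ae_all_iff.2 fun k : ℤ => hΦ.ae_unitMeasure_hasSum hJ (lam k a)).mono fun t ht k => ?_)
  rw [hJ.norm_proj_add]
  convert! ht k using 4 with φ
  rw [fiber_add, ← (lam k).inner_map_map, LinearIsometryEquiv.apply_symm_apply]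

theorem IsNTFGenerator.ae_localTracePos_eq (hJ : IsRangeFunctionOf θ V J)
    (hΦ : IsNTFGenerator θ V Φ) {T : L2Zn n →L[ℂ] L2Zn n} (hT : T.IsPositive) :
    ∀ᵐ ξ : ℝ, localTracePos J T ξ =
      ∑' φ : Φ, ENNReal.ofReal (RCLike.re (inner ℂ (fiber θ φ ξ) (T (fiber θ φ ξ)))) := by
  obtain ⟨D, hD, h⟩ := exists_tsum_inner_eq_posTrace hT countable_onb
  filter_upwards [(ae_ball_iff hD).2 fun a _ => hΦ.ae_hasSum hJ a] with ξ hξ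
  exact h (J ξ) hξ

theorem IsNTFGenerator.ae_hasSum_localTrace (hJ : IsRangeFunctionOf θ V J)
    (hΦ : IsNTFGenerator θ V Φ) {T : L2Zn n →L[ℂ] L2Zn n} (hT : IsTraceClass T) :
    ∀ᵐ ξ : ℝ, IsTraceClass (T ∘L proj (J ξ)) ∧
      HasSum (fun φ : Φ => inner ℂ (fiber θ φ ξ) (T (fiber θ φ ξ))) (localTrace J T ξ) := by
  obtain ⟨D, hD, h⟩ := hT.exists_hasSum_trace countable_onb
  filter_upwards [(ae_ball_iff hD).2 fun a _ => hΦ.ae_hasSum hJ a] with ξ hξ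
  exact ⟨(h (J ξ)).1, (h (J ξ)).2 hξ⟩

theorem IsNTFGenerator.ae_rankOneOp (hJ : IsRangeFunctionOf θ V J)
    (hΦ : IsNTFGenerator θ V Φ) (f : L2Zn n) :
    ∀ᵐ ξ : ℝ, localTracePos J (rankOneOp f) ξ =
        ∑' φ : Φ, ENNReal.ofReal (‖inner ℂ (fiber θ φ ξ) f‖ ^ 2) ∧
      HasSum (fun φ : Φ => ((‖inner ℂ (fiber θ φ ξ) f‖ ^ 2 : ℝ) : ℂ))
        (localTrace J (rankOneOp f) ξ) := by
  filter_upwards [hΦ.ae_localTracePos_eq hJ (isPositive_rankOneOp f),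
    hΦ.ae_hasSum_localTrace hJ (isTraceClass_rankOneOp f)] with ξ h1 h2
  simp only [inner_rankOneOp] at h1 h2
  exact ⟨h1, h2.2⟩

end RangeFunction

end LocalTrace

theorem mainTheorem1 {n : ℕ} (θ : Fin n → ℝ)
    (V : ClosedSubmodule ℂ (L2n n)) (hV : IsShiftInvariant θ V)
    (J : ℝ → ClosedSubmodule ℂ (L2Zn n)) (hJ : IsRangeFunctionOf θ V J)
    (Φ : Set (L2n n)) (hΦ : IsNTFGenerator θ V Φ) :
    -- positive operators: equality in `[0, ∞]`
    (∀ T : L2Zn n →L[ℂ] L2Zn n, T.IsPositive → ∀ᵐ ξ : ℝ,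
      localTracePos J T ξ =
        ∑' φ : Φ, ENNReal.ofReal (RCLike.re (inner ℂ (fiber θ φ ξ) (T (fiber θ φ ξ))))) ∧
    -- trace-class operators: the trace exists and the (absolutely convergent) sum equals it
    (∀ T : L2Zn n →L[ℂ] L2Zn n, IsTraceClass T → ∀ᵐ ξ : ℝ,
      IsTraceClass (T ∘L proj (J ξ)) ∧
      HasSum (fun φ : Φ => inner ℂ (fiber θ φ ξ) (T (fiber θ φ ξ))) (localTrace J T ξ)) ∧
    -- rank-one operators `P_f`, with both readings of the trace
    (∀ f : L2Zn n, ∀ᵐ ξ : ℝ,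
      localTracePos J (rankOneOp f) ξ =
        ∑' φ : Φ, ENNReal.ofReal (‖inner ℂ (fiber θ φ ξ) f‖ ^ 2) ∧
      HasSum (fun φ : Φ => ((‖inner ℂ (fiber θ φ ξ) f‖ ^ 2 : ℝ) : ℂ))
        (localTrace J (rankOneOp f) ξ)) ∧
    -- independence of the generator
    (∀ Ψ : Set (L2n n), IsNTFGenerator θ V Ψ →
      (∀ T : L2Zn n →L[ℂ] L2Zn n, T.IsPositive → ∀ᵐ ξ : ℝ,
        ∑' φ : Φ, ENNReal.ofReal (RCLike.re (inner ℂ (fiber θ φ ξ) (T (fiber θ φ ξ)))) =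
          ∑' ψ : Ψ, ENNReal.ofReal (RCLike.re (inner ℂ (fiber θ ψ ξ) (T (fiber θ ψ ξ))))) ∧
      (∀ T : L2Zn n →L[ℂ] L2Zn n, IsTraceClass T → ∀ᵐ ξ : ℝ,
        ∑' φ : Φ, inner ℂ (fiber θ φ ξ) (T (fiber θ φ ξ)) =
          ∑' ψ : Ψ, inner ℂ (fiber θ ψ ξ) (T (fiber θ ψ ξ))) ∧
      (∀ f : L2Zn n, ∀ᵐ ξ : ℝ,
        ∑' φ : Φ, ENNReal.ofReal (‖inner ℂ (fiber θ φ ξ) f‖ ^ 2) =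
          ∑' ψ : Ψ, ENNReal.ofReal (‖inner ℂ (fiber θ ψ ξ) f‖ ^ 2))) := by
  refine ⟨fun T hT => hΦ.ae_localTracePos_eq hJ hT, fun T hT => hΦ.ae_hasSum_localTrace hJ hT,
    fun f => hΦ.ae_rankOneOp hJ f, fun Ψ hΨ => ⟨fun T hT => ?_, fun T hT => ?_, fun f => ?_⟩⟩
  · filter_upwards [hΦ.ae_localTracePos_eq hJ hT, hΨ.ae_localTracePos_eq hJ hT] with ξ h1 h2
    exact h1.symm.trans h2
  · filter_upwards [hΦ.ae_hasSum_localTrace hJ hT, hΨ.ae_hasSum_localTrace hJ hT] with ξ h1 h2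
    exact h1.2.tsum_eq.trans h2.2.tsum_eq.symm
  · filter_upwards [hΦ.ae_rankOneOp hJ f, hΨ.ae_rankOneOp hJ f] with ξ h1 h2
    exact h1.1.symm.trans h2.1
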